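/- Let $\mathcal G$ be a DAG on a finite vertex set $V$ that is moral, i.e. has no v-structure: there are no distinct vertices $u,v,w$ with $u\to v\leftarrow w$ and $u,w$ non-adjacent. Let $v\in V$. Write $\mathrm{Des}(v)$ for the set of descendants of $v$ (vertices reachable from $v$ by a directed path with at least one arc) and $\mathrm{Des}[v]=\mathrm{Des}(v)\cup\{v\}$. Two DAGs on $V$ are Markov equivalent if the same positive joint distributions $P$ (of random variables indexed by $V$ with finite state spaces) factorize according to them, i.e. satisfy $P(x)=\prod_{w\in V}P(x_w\mid x_{\mathrm{Pa}(w)})$ with $\mathrm{Pa}(w)$ the set of parents of $w$ in the DAG. Consider the DAGs that are Markov equivalent to $\mathcal G$ and in which every edge between $v$ and $V\setminus\{v\}$ is present with the same orientation as in $\mathcal G$ (and no other such edge is present). The essential graph $\mathcal E_v(\mathcal G)$ of the intervention on $v$ is the partially oriented graph on $V$ with the oriented arc $a\to b$ if $a\to b$ in all of these DAGs, and with the undirected edge $a\sim b$ if $a\to b$ in one of them and $b\to a$ in another. Let $CC(\mathcal E_v(\mathcal G))$ be the set of connected components of the undirected graph on $V$ that remains when all oriented arcs are removed from $\mathcal E_v(\mathcal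 G)$. Then every $\mathcal H\in CC(\mathcal E_v(\mathcal G))$ satisfies $$V(\mathcal H)=\{v\}\quad\text{or}\quad V(\mathcal H)\subseteq \mathrm{Des}(v)\quad\text{or}\quad V(\mathcal H)\subseteq V\setminus \mathrm{Des}[v].$$ In other words, no undirected edge of $\mathcal E_v(\mathcal G)$ joins a vertex outside $\mathrm{Des}(v)$ to a vertex of $\mathrm{Des}(v)$. -/

import Mathlib

/-- A directed acyclic graph on the vertex set `V`: a digraph without directed cycles
(in particular without loops). -/
structure DAG (V : Type*) extends Digraph V where
  acyclic : ∀ v, ¬ Relation.TransGen Adj v v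

namespace DAG

/-- The parents of `v`. -/
def Pa {V : Type*} (G : DAG V) (v : V) : Set V := {u | G.Adj u v}

/-- The (proper) descendants `Des(v)`: the vertices reachable from `v` by a directed path with at
least one arc. By acyclicity, `v` is not one of them. -/
def Des {V : Type*} (G : DAG V) (v : V) : Set V := {w | Relation.TransGen G.Adj v w}

/-- `Des[v] = Des(v) ∪ {v}`. -/
def DesClosed {V : Type*} (G : DAG V) (v : V) : Set V := G.Des v ∪ {v}

/-- The skeleton: all arcs are made undirected. -/
def skeleton {V : Type*} (G : DAG V) : SimpleGraph V := G.toDigraph.toSimpleGraphInclusive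

/-- `u → v ← w` is a v-structure: `u`, `v`, `w` are distinct and `u`, `w` are not adjacent. -/
def IsVStructure {V : Type*} (G : DAG V) (u v w : V) : Prop :=
  u ≠ v ∧ v ≠ w ∧ u ≠ w ∧ G.Adj u v ∧ G.Adj w v ∧ ¬ G.skeleton.Adj u w

/-- A moral DAG is a DAG without v-structures. -/
def IsMoral {V : Type*} (G : DAG V) : Prop := ∀ u v w, ¬ G.IsVStructure u v w

end DAG

/-- `p` is the mass function of a positive joint distribution of random variables indexed by `V`,
where the variable at `w` takes values in the finite set `X w`. -/
def IsPositiveDistribution {V : Type*} [Fintype V] [DecidableEq V] {X : V → Type}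
    [∀ w, Fintype (X w)] (p : (∀ w, X w) → ℝ) : Prop :=
  (∀ x, 0 < p x) ∧ ∑ x, p x = 1

open Classical in
/-- `marginal p S x` is the probability that the variables in `S` take the values that they have
in `x`. -/
noncomputable def marginal {V : Type*} [Fintype V] [DecidableEq V] {X : V → Type}
    [∀ w, Fintype (X w)] (p : (∀ w, X w) → ℝ) (S : Set V) (x : ∀ w, X w) : ℝ :=
  ∑ y with ∀ s ∈ S, y s = x s, p y

/-- `condProb p v S x` is the conditional probability `P(x_v ∣ x_S)`. -/
noncomputable def condProb {V : Type*} [Fintype V] [DecidableEq V] {X : V → Type}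
    [∀ w, Fintype (X w)] (p : (∀ w, X w) → ℝ) (v : V) (S : Set V) (x : ∀ w, X w) : ℝ :=
  marginal p (insert v S) x / marginal p S x

namespace DAG

/-- `p` factorizes according to `G`: `P(x) = ∏ v, P(x_v ∣ x_{Pa(v)})`. -/
def Factorizes {V : Type*} [Fintype V] [DecidableEq V] (G : DAG V) {X : V → Type}
    [∀ w, Fintype (X w)] (p : (∀ w, X w) → ℝ) : Prop :=
  ∀ x, p x = ∏ v, condProb p v (G.Pa v) x

/-- Markov equivalence: the same positive distributions factorize according to both DAGs. -/
def MarkovEquivalent {V : Type*} [Fintype V] [DecidableEq V] (G₁ G₂ : DAG V) : Prop :=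
  ∀ (X : V → Type) [∀ w, Fintype (X w)] (p : (∀ w, X w) → ℝ),
    IsPositiveDistribution p → (G₁.Factorizes p ↔ G₂.Factorizes p)

/-- The Markov equivalence class `[G]`. -/
def MEC {V : Type*} [Fintype V] [DecidableEq V] (G : DAG V) : Set (DAG V) :=
  {G' | G.MarkovEquivalent G'}

/-- The DAGs in `[G]` in which, for every `I ∈ 𝓘`, the arcs between `I` and its complement are
oriented as in `G`. -/
def interventionalMEC {V : Type*} [Fintype V] [DecidableEq V] (G : DAG V) (𝓘 : Set (Set V)) :
    Set (DAG V) :=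
  {G' | G' ∈ G.MEC ∧ ∀ I ∈ 𝓘, ∀ u ∈ I, ∀ w ∉ I,
    (G'.Adj u w ↔ G.Adj u w) ∧ (G'.Adj w u ↔ G.Adj w u)}

theorem self_mem_interventionalMEC {V : Type*} [Fintype V] [DecidableEq V] (G : DAG V)
    (𝓘 : Set (Set V)) : G ∈ G.interventionalMEC 𝓘 :=
  ⟨fun _ _ _ _ => Iff.rfl, fun _ _ _ _ _ _ => ⟨Iff.rfl, Iff.rfl⟩⟩

theorem adj_asymm {V : Type*} (G : DAG V) {u v : V} (h : G.Adj u v) : ¬ G.Adj v u :=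
  fun h' => G.acyclic u ((Relation.TransGen.single h).tail h')

end DAG

/-- A partially oriented graph: oriented arcs together with undirected edges. -/
structure PartiallyOrientedGraph (V : Type*) where
  /-- the oriented arcs -/
  Arc : V → V → Prop
  /-- the graph of the undirected edges, which is what remains after all arcs are removed -/
  undirected : SimpleGraph V
  arc_asymm : ∀ u v, Arc u v → ¬ Arc v u
  disjoint : ∀ u v, Arc u v → ¬ undirected.Adj u v

/-- `CC(E)`: the connected components of the undirected graph on all of `V` that is obtained by
removing the oriented arcs. -/
abbrev PartiallyOrientedGraph.CC {V : Type*} (E : PartiallyOrientedGraph V) : Type _ :=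
  E.undirected.ConnectedComponent

/-- The `𝓘`-essential graph of `G`: an arc `u → v` is oriented if it is present in every DAG of the
class, and `u ∼ v` is undirected if two DAGs of the class orient it in opposite directions. -/
def DAG.essentialGraph {V : Type*} [Fintype V] [DecidableEq V] (G : DAG V) (𝓘 : Set (Set V)) :
    PartiallyOrientedGraph V where
  Arc u v := ∀ D ∈ G.interventionalMEC 𝓘, D.Adj u v
  undirected :=
    { Adj := fun u v => ∃ D₁ ∈ G.interventionalMEC 𝓘, ∃ D₂ ∈ G.interventionalMEC 𝓘,
        D₁.Adj u v ∧ D₂.Adj v u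
      symm := ⟨fun _ _ ⟨D₁, h₁, D₂, h₂, a₁, a₂⟩ => ⟨D₂, h₂, D₁, h₁, a₂, a₁⟩⟩
      loopless := ⟨fun _ ⟨D₁, _, _, _, a₁, _⟩ => D₁.adj_asymm a₁ a₁⟩ }
  arc_asymm _ _ h h' := G.adj_asymm (h G (G.self_mem_interventionalMEC 𝓘))
    (h' G (G.self_mem_interventionalMEC 𝓘))
  disjoint _ _ h := fun ⟨_, _, D₂, h₂, _, a₂⟩ => D₂.adj_asymm (h D₂ h₂) a₂

/-! Markov equivalence is tested on parity distributions: the uniform law on `V → Bool`, tilted by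
the parity of the coordinates in `S`, factorizes exactly when `S` has a sink. Pairs then detect
adjacency and triples detect v-structures, so every `D` in the class of `G` is moral with the same
skeleton. Suppose `D` reverses an arc `a → b` of `G`, where `b` descends from `v` and `a` does not.
By morality of `G`, the arc from `a` can be pulled back along a path from `v` to `b`, giving `a → v`
(`IsMoral.adj_of_not_mem_Des`); the intervention keeps this arc in `D`. It also keeps the arcs
leaving `v`, which makes `b` a descendant of `v` in `D` (`Des_subset_Des`). So `v ⇝ b → a → v` is a
cycle in `D`. -/

namespace DAG

variable {V : Type*}

theorem adj_ne (G : DAG V) {u v : V} (h : G.Adj u v) : u ≠ v := by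
  rintro rfl
  exact G.adj_asymm h h

theorem skeleton_adj (G : DAG V) {u v : V} : G.skeleton.Adj u v ↔ G.Adj u v ∨ G.Adj v u := by
  constructor
  · intro h
    simpa [skeleton, Digraph.toSimpleGraphInclusive, h.ne] using h
  · intro h
    have hne : u ≠ v := h.elim G.adj_ne fun h => (G.adj_ne h).symm
    simpa [skeleton, Digraph.toSimpleGraphInclusive, hne] using h

/-- `S` has a sink: a member all of whose fellow members are its parents. -/
def HasSink (G : DAG V) (S : Set V) : Prop := ∃ s ∈ S, ∀ t ∈ S, t ≠ s → G.Adj t s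

theorem hasSink_pair (G : DAG V) {u w : V} (h : u ≠ w) :
    G.HasSink {u, w} ↔ G.Adj u w ∨ G.Adj w u := by
  simp only [HasSink, Set.mem_insert_iff, Set.mem_singleton_iff]
  constructor
  · rintro ⟨s, rfl | rfl, hs⟩
    · exact Or.inr (hs w (Or.inr rfl) h.symm)
    · exact Or.inl (hs u (Or.inl rfl) h)
  · rintro (h' | h')
    · exact ⟨w, Or.inr rfl, by rintro t (rfl | rfl) ht <;> [exact h'; exact absurd rfl ht]⟩
    · exact ⟨u, Or.inl rfl, by rintro t (rfl | rfl) ht <;> [exact absurd rfl ht; exact h']⟩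

/-- The left side is the condition under which the conditional factor at `s` sees the parity
perturbation, see `condProb_parityDist`. -/
theorem subset_insert_Pa_iff (G : DAG V) (S : Finset V) (s : V) :
    ((S : Set V) ⊆ insert s (G.Pa s) ∧ ¬ (S : Set V) ⊆ G.Pa s) ↔
      s ∈ S ∧ ∀ t ∈ S, t ≠ s → G.Adj t s := by
  constructor
  · rintro ⟨h₁, h₂⟩
    refine ⟨?_, fun t ht hts => (h₁ ht).resolve_left hts⟩
    by_contra hs
    exact h₂ fun t ht => (h₁ ht).resolve_left (by rintro rfl; exact hs ht)
  · rintro ⟨hs, h⟩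
    exact ⟨fun t ht => or_iff_not_imp_left.2 (h t ht), fun hsub => G.adj_ne (hsub hs) rfl⟩

end DAG

/-! ### Parity distributions: marginals and conditional probabilities. -/

section Parity

variable {V : Type*}

/-- The product of the signs of the coordinates in `S`. -/
def paritySign (S : Finset V) (y : V → Bool) : ℝ := ∏ i ∈ S, if y i then 1 else -1

theorem paritySign_eq_or (S : Finset V) (y : V → Bool) :
    paritySign S y = 1 ∨ paritySign S y = -1 := by
  classical
  unfold paritySign
  induction S using Finset.induction_on with
  | empty => simp
  | insert i S hi ih =>
    rw [Finset.prod_insert hi]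
    split_ifs <;> rcases ih with h | h <;> simp [h]

theorem one_add_paritySign_pos (S : Finset V) (y : V → Bool) : 0 < 1 + paritySign S y / 2 := by
  rcases paritySign_eq_or S y with h | h <;> rw [h] <;> norm_num

theorem paritySign_update_not [DecidableEq V] {S : Finset V} {i : V} (hi : i ∈ S) (y : V → Bool) :
    paritySign S (Function.update y i (!y i)) = -paritySign S y := by
  unfold paritySign
  rw [← Finset.mul_prod_erase S _ hi, ← Finset.mul_prod_erase S _ hi]
  have : ∏ x ∈ S.erase i, (if Function.update y i (!y i) x = true then (1 : ℝ) else -1) =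
      ∏ x ∈ S.erase i, (if y x = true then (1 : ℝ) else -1) :=
    Finset.prod_congr rfl fun x hx => by
      rw [Function.update_of_ne (Finset.ne_of_mem_erase hx)]
  rw [this]
  cases y i <;> simp

variable [Fintype V] [DecidableEq V]

/-- The uniform distribution on `V → Bool`, perturbed by the parity of the coordinates in `S`. -/
noncomputable def parityDist (S : Finset V) (y : V → Bool) : ℝ :=
  (1 + paritySign S y / 2) / 2 ^ Fintype.card V

open Classical in
-- Flipping a coordinate in `S` outside `T` is a sign-reversing involution.
theorem sum_paritySign_of_not_subset {S : Finset V} {T : Set V} (h : ¬ (S : Set V) ⊆ T)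
    (x : V → Bool) : ∑ y with ∀ t ∈ T, y t = x t, paritySign S y = 0 := by
  obtain ⟨i, hiS, hiT⟩ := Set.not_subset.1 h
  refine Finset.sum_involution (fun y _ => Function.update y i (!y i)) ?_ ?_ ?_ ?_
  · intro y _
    rw [paritySign_update_not hiS]
    ring
  · intro y _ _ he
    have := congrFun he i
    simp at this
  · intro y hy
    simp only [Finset.mem_filter, Finset.mem_univ, true_and] at hy ⊢
    intro t ht
    rw [Function.update_of_ne (by rintro rfl; exact hiT ht)]
    exact hy t ht
  · intro y _
    simp

open Classical in
theorem sum_paritySign_of_subset {S : Finset V} {T : Set V} (h : (S : Set V) ⊆ T)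
    (x : V → Bool) : ∑ y with ∀ t ∈ T, y t = x t, paritySign S y =
      (∑ y : V → Bool with ∀ t ∈ T, y t = x t, (1 : ℝ)) * paritySign S x := by
  rw [Finset.sum_mul]
  refine Finset.sum_congr rfl fun y hy => ?_
  simp only [Finset.mem_filter, Finset.mem_univ, true_and] at hy
  rw [one_mul]
  exact Finset.prod_congr rfl fun i hi => by rw [hy i (h hi)]

open Classical in
/-- The number of Boolean vectors with prescribed coordinates in `T`. -/
noncomputable def agreeCount (T : Set V) : ℝ := ∏ t : V, if t ∈ T then 1 else 2

open Classical in
theorem sum_one_agree (T : Set V) (x : V → Bool) :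
    ∑ y : V → Bool with ∀ t ∈ T, y t = x t, (1 : ℝ) = agreeCount T := by
  have : (Finset.univ.filter fun y : V → Bool => ∀ t ∈ T, y t = x t) =
      Fintype.piFinset fun t => if t ∈ T then {x t} else Finset.univ := by
    ext y
    simp only [Finset.mem_filter, Finset.mem_univ, true_and, Fintype.mem_piFinset]
    refine forall_congr' fun t => ?_
    split_ifs with h <;> simp [h]
  rw [this, Finset.sum_const, Fintype.card_piFinset, nsmul_eq_mul, mul_one, Nat.cast_prod]
  refine Finset.prod_congr rfl fun t _ => ?_
  split_ifs <;> simp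

omit [DecidableEq V] in
theorem agreeCount_pos (T : Set V) : 0 < agreeCount T :=
  Finset.prod_pos fun t _ => by split_ifs <;> norm_num

theorem agreeCount_eq_two_mul {T : Set V} {v : V} (hv : v ∉ T) :
    agreeCount T = 2 * agreeCount (insert v T) := by
  classical
  unfold agreeCount
  rw [← Finset.mul_prod_erase _ _ (Finset.mem_univ v),
    ← Finset.mul_prod_erase _ _ (Finset.mem_univ v)]
  simp only [hv, if_false, Set.mem_insert_iff, true_or, if_true, one_mul]
  congr 1
  refine Finset.prod_congr rfl fun t ht => ?_
  simp [Finset.ne_of_mem_erase ht]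

open Classical in
theorem marginal_parityDist (S : Finset V) (T : Set V) (x : V → Bool) :
    marginal (parityDist S) T x = agreeCount T *
      (if (S : Set V) ⊆ T then 1 + paritySign S x / 2 else 1) / 2 ^ Fintype.card V := by
  have hsum : marginal (parityDist S) T x =
      ((∑ y : V → Bool with ∀ t ∈ T, y t = x t, (1 : ℝ)) +
        (∑ y with ∀ t ∈ T, y t = x t, paritySign S y) / 2) / 2 ^ Fintype.card V := by
    unfold marginal parityDist
    rw [← Finset.sum_div, Finset.sum_add_distrib, Finset.sum_div]
    congr!
  rw [hsum]
  split_ifs with h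
  · rw [sum_paritySign_of_subset h, sum_one_agree]
    ring
  · rw [sum_paritySign_of_not_subset h, sum_one_agree]
    ring

theorem isPositiveDistribution_parityDist {S : Finset V} (hS : S.Nonempty) :
    IsPositiveDistribution (X := fun _ => Bool) (parityDist S) := by
  refine ⟨fun x => div_pos (one_add_paritySign_pos S x) (by positivity), ?_⟩
  -- The marginal on `∅` is the total mass; as `S` is nonempty, the perturbation cancels in it.
  have h := marginal_parityDist S ∅ fun _ => true
  have hne : ¬ (S : Set V) ⊆ ∅ := by simpa [Set.subset_empty_iff] using hS.ne_empty
  rw [if_neg hne] at h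
  simpa [marginal, agreeCount] using h

open Classical in
-- A marginal sees the parity only if it contains all of `S`, so the ratio keeps the perturbation
-- only when `v` is the element completing `S`.
theorem condProb_parityDist (S : Finset V) {T : Set V} {v : V} (hv : v ∉ T) (x : V → Bool) :
    condProb (parityDist S) v T x = 2⁻¹ *
      if (S : Set V) ⊆ insert v T ∧ ¬ (S : Set V) ⊆ T then 1 + paritySign S x / 2 else 1 := by
  have hpos := agreeCount_pos (insert v T)
  have hx := one_add_paritySign_pos S x
  unfold condProb
  rw [marginal_parityDist, marginal_parityDist, agreeCount_eq_two_mul hv]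
  generalize agreeCount (insert v T) = c at hpos
  generalize 1 + paritySign S x / 2 = e at hx
  by_cases h₁ : (S : Set V) ⊆ T
  · have h₂ : (S : Set V) ⊆ insert v T := h₁.trans (Set.subset_insert v T)
    simp only [h₁, h₂, if_true, not_true, and_false, if_false]
    field_simp
  · by_cases h₂ : (S : Set V) ⊆ insert v T
    · simp only [h₁, h₂, if_true, not_false_eq_true, and_self, if_false]
      field_simp
    · simp only [h₁, h₂, false_and, if_false]
      field_simp

/-! ### Skeleton and v-structures as invariants of Markov equivalence. -/

namespace DAG

/-- The parity distribution of `S` factorizes according to `G` iff `S` has a sink in `G`. -/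
theorem factorizes_parityDist_iff (G : DAG V) (S : Finset V) :
    G.Factorizes (X := fun _ => Bool) (parityDist S) ↔ G.HasSink S := by
  classical
  have hprod : ∀ x : V → Bool, ∏ s, condProb (X := fun _ => Bool) (parityDist S) s (G.Pa s) x =
      (∏ s, if s ∈ S ∧ ∀ t ∈ S, t ≠ s → G.Adj t s then 1 + paritySign S x / 2 else 1) /
        2 ^ Fintype.card V := by
    intro x
    have h : ∀ s, condProb (X := fun _ => Bool) (parityDist S) s (G.Pa s) x = 2⁻¹ *
        if s ∈ S ∧ ∀ t ∈ S, t ≠ s → G.Adj t s then 1 + paritySign S x / 2 else 1 := fun s => by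
      have hs : s ∉ G.Pa s := fun hs => G.adj_ne hs rfl
      rw [condProb_parityDist S hs]
      simp only [G.subset_insert_Pa_iff]
    simp only [h]
    rw [Finset.prod_mul_distrib, Finset.prod_const, Finset.card_univ, inv_pow]
    ring
  constructor
  · intro hG
    by_contra hno
    -- Without a sink every factor is `1/2`, but at the all-true vector the mass is `3/2` times the
    -- uniform one.
    have hx := hG fun _ => true
    rw [hprod, Finset.prod_eq_one] at hx
    · have hsign : paritySign S (fun _ => true) = 1 := by simp [paritySign]
      rw [parityDist, hsign, div_left_inj' (by positivity)] at hx
      norm_num at hx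
    · intro s _
      exact if_neg fun h => hno ⟨s, h.1, h.2⟩
  · rintro ⟨s, hs, hsink⟩ x
    rw [hprod, Finset.prod_eq_single s, if_pos ⟨hs, hsink⟩]
    · rfl
    · rintro t - hts
      -- A second sink would be both a parent and a child of the first, so exactly one factor is
      -- perturbed.
      exact if_neg fun h => G.adj_asymm (hsink t h.1 hts) (h.2 s hs hts.symm)
    · simp

theorem MarkovEquivalent.hasSink_iff {G₁ G₂ : DAG V} (h : G₁.MarkovEquivalent G₂)
    {S : Finset V} (hS : S.Nonempty) : G₁.HasSink S ↔ G₂.HasSink S := by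
  rw [← G₁.factorizes_parityDist_iff S, ← G₂.factorizes_parityDist_iff S]
  exact h _ _ (isPositiveDistribution_parityDist hS)

/-- Markov equivalent DAGs have the same skeleton. -/
theorem MarkovEquivalent.adj_or_adj_iff {G₁ G₂ : DAG V} (h : G₁.MarkovEquivalent G₂) {u w : V} :
    G₁.Adj u w ∨ G₁.Adj w u ↔ G₂.Adj u w ∨ G₂.Adj w u := by
  rcases eq_or_ne u w with rfl | huw
  · simp only [or_self]
    exact ⟨fun h => absurd rfl (G₁.adj_ne h), fun h => absurd rfl (G₂.adj_ne h)⟩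
  · rw [← G₁.hasSink_pair huw, ← G₂.hasSink_pair huw]
    simpa using h.hasSink_iff (S := {u, w}) (by simp)

/-- Markov equivalent DAGs have the same v-structures. -/
theorem MarkovEquivalent.isVStructure {G₁ G₂ : DAG V} (h : G₁.MarkovEquivalent G₂) {u c w : V}
    (hv : G₂.IsVStructure u c w) : G₁.IsVStructure u c w := by
  obtain ⟨huc, hcw, huw, hu, hw, hn⟩ := hv
  rw [skeleton_adj, ← h.adj_or_adj_iff] at hn
  have hsink : G₂.HasSink ({u, c, w} : Finset V) := by
    refine ⟨c, by simp, fun t ht htc => ?_⟩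
    simp only [Finset.coe_insert, Finset.coe_singleton, Set.mem_insert_iff,
      Set.mem_singleton_iff] at ht
    rcases ht with rfl | rfl | rfl
    · exact hu
    · exact absurd rfl htc
    · exact hw
  obtain ⟨s, hs, hall⟩ := (h.hasSink_iff (by simp)).2 hsink
  simp only [Finset.coe_insert, Finset.coe_singleton, Set.mem_insert_iff,
    Set.mem_singleton_iff] at hs hall
  -- A sink at `u` or `w` would make these two adjacent, so the sink is `c`.
  rcases hs with rfl | rfl | rfl
  · exact absurd (Or.inr (hall w (by simp) huw.symm)) hn
  · exact ⟨huc, hcw, huw, hall u (by simp) huc, hall w (by simp) hcw.symm,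
      by rwa [skeleton_adj]⟩
  · exact absurd (Or.inl (hall u (by simp) huw)) hn

theorem MarkovEquivalent.isMoral {G₁ G₂ : DAG V} (h : G₁.MarkovEquivalent G₂)
    (hG : G₁.IsMoral) : G₂.IsMoral :=
  fun u c w hv => hG u c w (h.isVStructure hv)

end DAG

end Parity

/-! ### Descendants in moral DAGs and undirected edges of the essential graph. -/

namespace DAG

variable {V : Type*}

theorem IsMoral.adj_or_adj {G : DAG V} (hG : G.IsMoral) {u c w : V} (hu : G.Adj u c)
    (hw : G.Adj w c) (huw : u ≠ w) : G.Adj u w ∨ G.Adj w u := by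
  by_contra hn
  exact hG u c w ⟨G.adj_ne hu, (G.adj_ne hw).symm, huw, hu, hw, by rwa [skeleton_adj]⟩

/-- In a moral DAG, a non-descendant of `v` pointing to a descendant of `v` is a parent of `v`. -/
theorem IsMoral.adj_of_not_mem_Des {G : DAG V} (hG : G.IsMoral) {v a b : V}
    (hav : a ≠ v) (ha : a ∉ G.Des v) (hb : Relation.ReflTransGen G.Adj v b) (hab : G.Adj a b) :
    G.Adj a v := by
  induction hb with
  | refl => exact hab
  | @tail y z hvy hyz ih =>
    have hay : a ≠ y := by
      rintro rfl
      rcases Relation.reflTransGen_iff_eq_or_transGen.1 hvy with h | h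
      · exact hav h
      · exact ha h
    -- The parents `a` and `y` of `z` are adjacent, and `y → a` would make `a` a descendant of `v`.
    refine ih ((hG.adj_or_adj hab hyz hay).resolve_right fun h => ha ?_)
    exact Relation.TransGen.tail' hvy h

/-- Two moral DAGs with the same skeleton, with all arcs leaving `v` in the first one present in
the second: then each descendant of `v` in the first one is a descendant in the second one. -/
theorem Des_subset_Des {G D : DAG V} (hD : D.IsMoral)
    (hskel : ∀ u w, G.Adj u w ∨ G.Adj w u ↔ D.Adj u w ∨ D.Adj w u) {v : V}
    (hv : ∀ w, G.Adj v w → D.Adj v w) : G.Des v ⊆ D.Des v := by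
  -- A path of arcs common to both DAGs is sought; this stronger claim is what the induction needs.
  let R : V → V → Prop := fun x y => G.Adj x y ∧ D.Adj x y
  have key : ∀ x, Relation.ReflTransGen R v x → ∀ z, G.Adj x z → Relation.TransGen R v z := by
    intro x hx
    induction hx with
    | refl => exact fun z hz => .single ⟨hz, hv z hz⟩
    | @tail y x hvy hyx ih =>
      intro z hxz
      rcases (hskel x z).1 (Or.inl hxz) with h | h
      · exact Relation.TransGen.tail' (hvy.tail hyx) ⟨hxz, h⟩
      -- If `D` reverses `x → z`, then `y` and `z` are both parents of `x` in `D`, hence adjacent.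
      -- In `G`, `z → y` would close a cycle, so `y → z` there, and the path can bypass `x` by
      -- induction at `y`.
      · have hyz : y ≠ z := by
          rintro rfl
          exact G.adj_asymm hyx.1 hxz
        refine ih z (((hskel y z).2 (hD.adj_or_adj hyx.2 h hyz)).resolve_right fun hzy => ?_)
        exact G.acyclic x (((Relation.TransGen.single hxz).tail hzy).tail hyx.1)
  intro b hb
  have hR : Relation.TransGen R v b := by
    induction hb with
    | single h => exact key v .refl _ h
    | tail _ h ih => exact key _ ih.to_reflTransGen _ h
  exact Relation.TransGen.mono (fun _ _ h => h.2) _ _ hR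

variable [Fintype V] [DecidableEq V]

theorem adj_iff_of_mem_interventionalMEC_singleton {G D : DAG V} {v : V}
    (hD : D ∈ G.interventionalMEC {{v}}) (w : V) :
    (D.Adj v w ↔ G.Adj v w) ∧ (D.Adj w v ↔ G.Adj w v) := by
  rcases eq_or_ne w v with rfl | hw
  -- The class only constrains arcs between `v` and other vertices; at `v` itself both DAGs are
  -- loopless.
  · have h : D.Adj w w ↔ G.Adj w w :=
      ⟨fun h => absurd rfl (D.adj_ne h), fun h => absurd rfl (G.adj_ne h)⟩
    exact ⟨h, h⟩
  · exact hD.2 {v} rfl v rfl w hw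

theorem not_essentialGraph_singleton_undirected_adj (G : DAG V) (v w : V) :
    ¬ (G.essentialGraph {{v}}).undirected.Adj v w := by
  rintro ⟨D₁, h₁, D₂, h₂, a₁, a₂⟩
  exact G.adj_asymm ((adj_iff_of_mem_interventionalMEC_singleton h₁ w).1.1 a₁)
    ((adj_iff_of_mem_interventionalMEC_singleton h₂ w).2.1 a₂)

theorem IsMoral.not_undirected_adj_of_mem_Des {G : DAG V} (hG : G.IsMoral) {v a b : V}
    (ha : a ∉ G.Des v) (hb : b ∈ G.Des v) :
    ¬ (G.essentialGraph {{v}}).undirected.Adj a b := by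
  intro hadj
  have hav : a ≠ v := by
    rintro rfl
    exact G.not_essentialGraph_singleton_undirected_adj a b hadj
  obtain ⟨-, -, D, hD, -, hba⟩ := hadj
  have hab : G.Adj a b := (hD.1.adj_or_adj_iff.2 (Or.inr hba)).resolve_right
    fun h => ha (Relation.TransGen.tail hb h)
  have hD_av : D.Adj a v := (adj_iff_of_mem_interventionalMEC_singleton hD a).2.2
    (hG.adj_of_not_mem_Des hav ha (Relation.TransGen.to_reflTransGen hb) hab)
  have hD_vb : b ∈ D.Des v := Des_subset_Des (hD.1.isMoral hG)
    (fun _ _ => hD.1.adj_or_adj_iff)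
    (fun w => (adj_iff_of_mem_interventionalMEC_singleton hD w).1.2) hb
  exact D.acyclic v ((Relation.TransGen.tail hD_vb hba).tail hD_av)

end DAG

/-! ### From edges to connected components. -/

theorem SimpleGraph.Reachable.iff_of_adj {V : Type*} {G : SimpleGraph V} {Q : V → Prop}
    (hQ : ∀ a b, G.Adj a b → Q a → Q b) {a b : V} (h : G.Reachable a b) : Q a ↔ Q b := by
  obtain ⟨p⟩ := h
  induction p with
  | nil => rfl
  | cons h _ ih => exact ⟨fun ha => ih.1 (hQ _ _ h ha), fun hb => hQ _ _ h.symm (ih.2 hb)⟩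

theorem lemma4 {V : Type*} [Fintype V] [DecidableEq V] (G : DAG V) (hG : G.IsMoral) (v : V) :
    (∀ H : (G.essentialGraph {{v}}).CC,
      H.supp = {v} ∨ H.supp ⊆ G.Des v ∨ H.supp ⊆ (G.DesClosed v)ᶜ) ∧
    (∀ a ∉ G.Des v, ∀ b ∈ G.Des v, ¬ (G.essentialGraph {{v}}).undirected.Adj a b) := by
  have hcross : ∀ a ∉ G.Des v, ∀ b ∈ G.Des v, ¬ (G.essentialGraph {{v}}).undirected.Adj a b :=
    fun a ha b hb => hG.not_undirected_adj_of_mem_Des ha hb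
  refine ⟨fun H => ?_, hcross⟩
  induction H using SimpleGraph.ConnectedComponent.ind with | _ w
  -- No undirected edge meets `v`, so `v` is isolated and the propagation hypothesis is vacuous.
  have hv : ∀ x, (G.essentialGraph {{v}}).undirected.Reachable x w → (x = v ↔ w = v) :=
    fun x hx => hx.iff_of_adj (Q := (· = v)) fun a b hab ha => by
      subst ha
      exact absurd hab (G.not_essentialGraph_singleton_undirected_adj a b)
  have hdes : ∀ x, (G.essentialGraph {{v}}).undirected.Reachable x w →
      (x ∈ G.Des v ↔ w ∈ G.Des v) :=
    fun x hx => hx.iff_of_adj (Q := (· ∈ G.Des v)) fun a b hab ha => by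
      by_contra hb
      exact hcross b hb a ha hab.symm
  have hsupp : ∀ x, x ∈ ((G.essentialGraph {{v}}).undirected.connectedComponentMk w).supp ↔
      (G.essentialGraph {{v}}).undirected.Reachable x w := fun x => by
    rw [SimpleGraph.ConnectedComponent.mem_supp_iff, SimpleGraph.ConnectedComponent.eq]
  by_cases hwv : w = v
  · left
    ext x
    rw [hsupp]
    refine ⟨fun hx => (hv x hx).2 hwv, fun hx => ?_⟩
    rw [Set.mem_singleton_iff.1 hx, hwv]
  · right
    by_cases hw : w ∈ G.Des v
    · exact Or.inl fun x hx => (hdes x ((hsupp x).1 hx)).2 hw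
    · refine Or.inr fun x hx => ?_
      rintro (h | h)
      · exact hw ((hdes x ((hsupp x).1 hx)).1 h)
      · exact hwv ((hv x ((hsupp x).1 hx)).1 h)
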